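/- Let $n\ge 2$ be an integer, let $\alpha\in[0,1]$, and let $\phi$ be Euler's totient function. Let $\mathcal P(\mathbb Z_n)$ be the power graph of the additive cyclic group $\mathbb Z_n$: its vertices are the elements of $\mathbb Z_n$, and distinct $x,y$ are adjacent iff $ix=y$ or $jy=x$ for some integers $2\le i,j\le n$. For a finite simple graph $G$ with degree matrix $D(G)$ and adjacency matrix $A(G)$ put $A_\alpha(G)=\alpha D(G)+(1-\alpha)A(G)$; the $A_\alpha$-spectrum of $G$ is the multiset of eigenvalues of $A_\alpha(G)$. Let $d_1,\dots,d_r$ ($r\ge 0$) be the distinct divisors $d$ of $n$ with $1<d<n$. Let $\mathbb G_n$ be the graph with vertices $d_1,\dots,d_r$ in which two distinct vertices are adjacent iff one divides the other. Let $H=K_1\triangledown\mathbb G_n$ be its join with a single vertex $v_1$, and write $v_{i+1}$ for the vertex $d_i$ of $H$. Put $n_1=\phi(n)+1$, $n_{i+1}=\phi(d_i)$ for $1\le i\le r$, and $\alpha_i=\sum_{v_j\in N_H(v_i)}n_j$ for $2\le i\le r+1$. Let $M=(m_{ij})$ be the $(r+1)\times(r+1)$ real matrix with $$m_{11}=\phi(n)+\alpha\,(n-1-\phi(n)),\qquad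 m_{ii}=\alpha\alpha_i+\phi(d_{i-1})-1\quad(2\le i\le r+1),$$ and, for $i\ne j$, $m_{ij}=(1-\alpha)n_j$ if $v_i$ and $v_j$ are adjacent in $H$ and $m_{ij}=0$ otherwise. Then all $r+1$ eigenvalues of $M$, counted with algebraic multiplicity, are real, and the $A_\alpha$-spectrum of $\mathcal P(\mathbb Z_n)$ is the multiset union (multiplicities added) of - $\alpha n-1$ with multiplicity $\phi(n)$; - $\alpha\,(\phi(d_i)+\alpha_{i+1})-1$ with multiplicity $\phi(d_i)-1$, for each $i=1,\dots,r$; - the $r+1$ eigenvalues of $M$, counted with algebraic multiplicity. -/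

import Mathlib

/-- The undirected power graph of an additive group `G` (in multiplicative notation: distinct `x`, `y`
are adjacent iff `x ^ i = y` or `y ^ j = x` for some integers `2 ≤ i, j ≤ |G|`). -/
def powerGraph (G : Type*) [AddGroup G] : SimpleGraph G where
  Adj x y := x ≠ y ∧ ((∃ i : ℕ, 2 ≤ i ∧ i ≤ Nat.card G ∧ i • x = y) ∨
    (∃ j : ℕ, 2 ≤ j ∧ j ≤ Nat.card G ∧ j • y = x))
  symm := ⟨fun _ _ h => ⟨h.1.symm, h.2.symm⟩⟩
  loopless := ⟨fun _ h => h.1 rfl⟩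

noncomputable instance powerGraphDecidableAdj (G : Type*) [AddGroup G] :
    DecidableRel (powerGraph G).Adj := Classical.decRel _

/-- The matrix `A_α(G) = α D(G) + (1 - α) A(G)` of a finite graph. -/
def aAlphaMatrix {V : Type*} [Fintype V] [DecidableEq V] (G : SimpleGraph V)
    [DecidableRel G.Adj] (α : ℝ) : Matrix V V ℝ :=
  α • G.degMatrix ℝ + (1 - α) • G.adjMatrix ℝ

/-- The real eigenvalues of a real square matrix, with algebraic multiplicity. -/
noncomputable def realSpectrum {ι : Type*} [Fintype ι] [DecidableEq ι] (A : Matrix ι ι ℝ) :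
    Multiset ℝ := A.charpoly.roots

/-- The join of two graphs: disjoint union together with all edges between the two parts. -/
def graphJoin {V W : Type*} (G : SimpleGraph V) (H : SimpleGraph W) : SimpleGraph (V ⊕ W) :=
  (G ⊕g H) ⊔ completeBipartiteGraph V W

/-- The divisors `d` of `n` with `1 < d < n`. -/
def innerDivisors (n : ℕ) : Finset ℕ := n.divisors.filter fun d => 1 < d ∧ d < n

/-- The graph `𝔾_n`: vertices are the divisors `1 < d < n` of `n`; two distinct ones are adjacent
iff one divides the other. -/
def divisorGraph (n : ℕ) : SimpleGraph (innerDivisors n) :=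
  SimpleGraph.fromRel fun d e => (d : ℕ) ∣ (e : ℕ)

/-- The graph `H = K₁ ▽ 𝔾_n`. The vertex of `K₁` is `Sum.inl ()`, the divisor `d` is `Sum.inr d`. -/
def coneGraph (n : ℕ) : SimpleGraph (Unit ⊕ innerDivisors n) :=
  graphJoin (⊤ : SimpleGraph Unit) (divisorGraph n)

noncomputable instance coneGraphDecidableAdj (n : ℕ) : DecidableRel (coneGraph n).Adj :=
  Classical.decRel _

/-- The number of vertices of the clique attached to a vertex of `H`: `φ(n) + 1` for the vertex of
`K₁`, and `φ(d)` for the divisor `d`. -/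
def cliqueSize (n : ℕ) : Unit ⊕ innerDivisors n → ℕ
  | Sum.inl _ => n.totient + 1
  | Sum.inr d => (d : ℕ).totient

/-- The sum of the clique sizes over the neighbours in `H` of the vertex `v`. -/
noncomputable def neighbourSum (n : ℕ) (v : Unit ⊕ innerDivisors n) : ℕ :=
  ∑ w ∈ (coneGraph n).neighborFinset v, cliqueSize n w

/-- The diagonal entries `z` of the quotient matrix. -/
noncomputable def quotientDiag (n : ℕ) (α : ℝ) : Unit ⊕ innerDivisors n → ℝ
  | Sum.inl _ => (n.totient : ℝ) + α * ((n : ℝ) - 1 - (n.totient : ℝ))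
  | Sum.inr d => α * (neighbourSum n (Sum.inr d) : ℝ) + ((d : ℕ).totient : ℝ) - 1

/-- The quotient matrix `M`, with rows and columns indexed by the vertices of `H`. -/
noncomputable def quotientMatrix (n : ℕ) (α : ℝ) :
    Matrix (Unit ⊕ innerDivisors n) (Unit ⊕ innerDivisors n) ℝ :=
  Matrix.of fun v w =>
    if v = w then quotientDiag n α v
    else if (coneGraph n).Adj v w then (1 - α) * (cliqueSize n w : ℝ)
    else 0

/-!
In a finite cyclic group, `y` is a multiple of `x` iff the order of `y` divides the order of `x`, so
adjacency in the power graph of `ℤ/n` depends only on the orders of the two elements. Group the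
elements by order, putting zero and the generators, which are adjacent to everything, into one class
(`orderClass`). Each class is a clique, and two classes are completely joined or not joined at all,
according to the graph `H` (`powerGraph_zmod_adj_iff`). Degrees are therefore constant on classes
(`degree_powerGraph_zmod`).

Hence `A_α = E + P B Pᵀ`, where `P` is the indicator matrix of the partition, `B = cliqueWeight` is
indexed by the vertices of `H`, and `E` is diagonal with the value `e v = cliqueEigenvalue n α v` on
the class of `v` (`aAlphaMatrix_powerGraph_zmod`). As `Pᵀ P = N` is the diagonal matrix of class
sizes, the identity `det (1 - X Y) = det (1 - Y X)` gives
`det (t - A_α) = ∏ v, (t - e v) ^ (N v - 1) * det (t - diagonal e - B N)`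
(`Matrix.charpoly_diagonal_add_submatrix`), and `diagonal e + B N` is the quotient matrix
(`quotientMatrix_eq`). Taking roots yields the spectrum. The quotient matrix is not symmetric in
general, but its characteristic polynomial divides that of the symmetric matrix `A_α`, so all its
eigenvalues are real.
-/

/-! ### Characteristic polynomials of matrices constant on blocks -/

open Polynomial in
/-- Equality of characteristic polynomials is tested at the scalars `t` outside the range of `e`,
where `t - e v` is invertible. There the matrix is `(1 - X * Y) * D` with `D` diagonal, and `X * Y`
may be replaced by the smaller product `Y * X`. -/
theorem Matrix.charpoly_diagonal_add_submatrix {F V K : Type*} [Field F] [Infinite F]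
    [Fintype V] [DecidableEq V] [Fintype K] [DecidableEq K] (c : V → K)
    (hc : Function.Surjective c) (e : K → F) (B : Matrix K K F) :
    (diagonal (fun x => e (c x)) + B.submatrix c c).charpoly =
      (∏ v, (X - C (e v)) ^ ((Finset.univ.filter fun x => c x = v).card - 1)) *
        (diagonal e +
          B * diagonal fun v => ((Finset.univ.filter fun x => c x = v).card : F)).charpoly := by
  apply eq_of_infinite_eval_eq
  refine (Set.finite_range e).infinite_compl.mono fun t ht => ?_
  have hg : ∀ v, t - e v ≠ 0 := fun v h => ht ⟨v, (sub_eq_zero.1 h).symm⟩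
  rw [Set.mem_ofPred_eq, eval_mul, eval_charpoly, eval_charpoly, eval_prod]
  have h1 : scalar V t - (diagonal (fun x => e (c x)) + B.submatrix c c) =
      (1 - (1 : Matrix K K F).submatrix c id *
        (B * diagonal fun v => (t - e v)⁻¹).submatrix id c) *
          diagonal fun x => t - e (c x) := by
    ext x y
    rw [Matrix.mul_diagonal]
    simp only [sub_apply, add_apply, submatrix_apply, scalar_apply, mul_apply, one_apply, id,
      diagonal_apply]
    have := hg (c y)
    by_cases hxy : x = y
    · subst hxy; simp; field_simp; ring
    · simp [hxy]; field_simp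
  have h2 : (B * diagonal fun v => (t - e v)⁻¹).submatrix id c *
      (1 : Matrix K K F).submatrix c id =
      B * diagonal fun v => ((Finset.univ.filter fun x => c x = v).card : F) * (t - e v)⁻¹ := by
    ext v w
    rw [mul_diagonal, mul_apply]
    simp only [submatrix_apply, mul_diagonal, one_apply, id, mul_ite, mul_one, mul_zero]
    rw [← Finset.sum_filter, Finset.sum_congr rfl (g := fun _ => B v w * (t - e w)⁻¹)]
    · simp; ring
    · intro x hx; rw [(Finset.mem_filter.1 hx).2]
  have h3 : scalar K t - (diagonal e +
      B * diagonal fun v => ((Finset.univ.filter fun x => c x = v).card : F)) =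
      (1 - B * diagonal fun v => ((Finset.univ.filter fun x => c x = v).card : F) *
        (t - e v)⁻¹) * diagonal fun v => t - e v := by
    ext v w
    rw [mul_diagonal]
    simp only [sub_apply, add_apply, mul_diagonal, scalar_apply, one_apply, diagonal_apply]
    have := hg w
    by_cases hvw : v = w
    · subst hvw; simp; field_simp; ring
    · simp [hvw]; field_simp
  have h4 : ∏ x, (t - e (c x)) =
      (∏ v, (t - e v) ^ ((Finset.univ.filter fun x => c x = v).card - 1)) *
        ∏ v, (t - e v) := by
    rw [← Finset.prod_fiberwise' Finset.univ c fun v => t - e v, ← Finset.prod_mul_distrib]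
    refine Finset.prod_congr rfl fun v _ => ?_
    obtain ⟨x, hx⟩ := hc v
    have : 0 < (Finset.univ.filter fun x => c x = v).card :=
      Finset.card_pos.2 ⟨x, by simp [hx]⟩
    rw [Finset.prod_const, ← pow_succ, Nat.sub_add_cancel this]
  rw [h1, h3, det_mul, det_mul, det_diagonal, det_diagonal, det_one_sub_mul_comm, h2, h4]
  simp only [eval_pow, eval_sub, eval_X, eval_C]
  ring

/-! ### Adjacency in the power graph of a cyclic group -/

theorem mem_zmultiples_iff_addOrderOf_dvd {G : Type*} [AddGroup G] [IsAddCyclic G] [Finite G]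
    {x y : G} : y ∈ AddSubgroup.zmultiples x ↔ addOrderOf y ∣ addOrderOf x := by
  classical
  have := Fintype.ofFinite G
  refine ⟨addOrderOf_dvd_of_mem_zmultiples, fun h => ?_⟩
  -- Both sides contain `addOrderOf x` elements, as `addOrderOf x • z = 0` has no more solutions.
  have hsub : Finset.univ.filter (fun z => z ∈ AddSubgroup.zmultiples x) ⊆
      Finset.univ.filter fun z => addOrderOf x • z = 0 := by
    intro z hz
    simp only [Finset.mem_filter, Finset.mem_univ, true_and] at hz ⊢
    exact addOrderOf_dvd_iff_nsmul_eq_zero.1 (addOrderOf_dvd_of_mem_zmultiples hz)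
  have hcard : (Finset.univ.filter fun z => z ∈ AddSubgroup.zmultiples x).card =
      addOrderOf x := by
    rw [← Fintype.card_subtype, ← Nat.card_eq_fintype_card]
    exact Nat.card_zmultiples x
  have heq := Finset.eq_of_subset_of_card_le hsub
    ((IsAddCyclic.card_nsmul_eq_zero_le (addOrderOf_pos x)).trans hcard.ge)
  have : y ∈ Finset.univ.filter fun z => addOrderOf x • z = 0 := by
    simpa using addOrderOf_dvd_iff_nsmul_eq_zero.1 h
  rw [← heq] at this
  simpa using this

/-- In a finite cyclic group the bounds on the exponents in the power graph are immaterial: a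
multiple other than `x` itself can be written `i • x` with `2 ≤ i ≤ |G|`. -/
theorem powerGraph_adj_iff {G : Type*} [AddGroup G] [IsAddCyclic G] [Finite G] {x y : G} :
    (powerGraph G).Adj x y ↔
      x ≠ y ∧ (addOrderOf y ∣ addOrderOf x ∨ addOrderOf x ∣ addOrderOf y) := by
  have key : ∀ {x y : G}, x ≠ y →
      ((∃ i : ℕ, 2 ≤ i ∧ i ≤ Nat.card G ∧ i • x = y) ↔ addOrderOf y ∣ addOrderOf x) := by
    intro x y hxy
    rw [← mem_zmultiples_iff_addOrderOf_dvd]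
    constructor
    · rintro ⟨i, -, -, rfl⟩
      exact AddSubgroup.nsmul_mem_zmultiples x i
    · intro h
      rw [← mem_multiples_iff_mem_zmultiples] at h
      obtain ⟨i, hi⟩ := h
      have hi : i • x = y := hi
      have hpos : 0 < Nat.card G := Nat.card_pos
      have hmod : (i % Nat.card G) • x = y := by
        rw [← hi, mod_natCard_nsmul]
      have hlt := Nat.mod_lt i hpos
      rcases h0 : i % Nat.card G with _ | _ | k
      · -- The multiple `0 • x` is `|G| • x`, and `|G| ≠ 1` since `x ≠ y`.
        refine ⟨Nat.card G, ?_, le_rfl, ?_⟩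
        · have : Nontrivial G := ⟨x, y, hxy⟩
          exact Finite.one_lt_card
        · rw [card_nsmul_eq_zero']; rw [h0, zero_nsmul] at hmod; exact hmod
      · rw [h0] at hmod; simp at hmod; exact absurd hmod hxy
      · exact ⟨k + 2, by omega, by omega, by rw [← hmod, h0]⟩
  refine and_congr_right fun hxy => ?_
  rw [key hxy, key hxy.symm]

/-! ### The partition of `ℤ/n` into cliques -/

theorem mem_innerDivisors {n : ℕ} [NeZero n] {d : ℕ} :
    d ∈ innerDivisors n ↔ d ∣ n ∧ 1 < d ∧ d < n := by
  simp [innerDivisors, NeZero.ne n]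

/-- The vertex of `H` whose clique contains `x`: the order of `x` if this is an inner divisor of
`n`, and the apex if `x` is zero or a generator. -/
noncomputable def orderClass (n : ℕ) (x : ZMod n) : Unit ⊕ innerDivisors n :=
  if h : addOrderOf x ∈ innerDivisors n then Sum.inr ⟨addOrderOf x, h⟩ else Sum.inl ()

theorem orderClass_eq_inr {n : ℕ} {x : ZMod n} {d : innerDivisors n} :
    orderClass n x = Sum.inr d ↔ addOrderOf x = d := by
  unfold orderClass
  split_ifs with h
  · simp [Subtype.ext_iff]
  · simp only [false_iff]
    exact fun h' => h (h' ▸ d.2)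

theorem addOrderOf_zmod_dvd {n : ℕ} (x : ZMod n) : addOrderOf x ∣ n := by
  simpa using addOrderOf_dvd_natCard x

theorem orderClass_eq_inl {n : ℕ} [NeZero n] {x : ZMod n} {u : Unit} :
    orderClass n x = Sum.inl u ↔ addOrderOf x = 1 ∨ addOrderOf x = n := by
  have hdvd := addOrderOf_zmod_dvd x
  have hpos := Nat.pos_of_dvd_of_pos hdvd (NeZero.pos n)
  have hle := Nat.le_of_dvd (NeZero.pos n) hdvd
  unfold orderClass
  split_ifs with h
  · simp only [false_iff]
    rw [mem_innerDivisors] at h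
    omega
  · simp only [true_iff]
    rw [mem_innerDivisors] at h
    have : ¬ (1 < addOrderOf x ∧ addOrderOf x < n) := fun h' => h ⟨hdvd, h'⟩
    omega

theorem card_filter_orderClass {n : ℕ} [NeZero n] (hn : 2 ≤ n) (v : Unit ⊕ innerDivisors n) :
    (Finset.univ.filter fun x => orderClass n x = v).card = cliqueSize n v := by
  have key : ∀ d, d ∣ n → (Finset.univ.filter fun x : ZMod n => addOrderOf x = d).card =
      d.totient := fun d hd => IsAddCyclic.card_addOrderOf_eq_totient (by simpa using hd)
  rcases v with u | d
  · simp only [orderClass_eq_inl, cliqueSize]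
    rw [Finset.filter_or, Finset.card_union_of_disjoint, key 1 (one_dvd n), key n dvd_rfl,
      Nat.totient_one, add_comm]
    rw [Finset.disjoint_filter]
    intro x _ h1 h2
    omega
  · simp only [orderClass_eq_inr, cliqueSize]
    exact key d (mem_innerDivisors.1 d.2).1

theorem orderClass_surjective {n : ℕ} [NeZero n] (hn : 2 ≤ n) :
    Function.Surjective (orderClass n) := by
  intro v
  have hpos : 0 < cliqueSize n v := by
    rcases v with u | d
    · exact Nat.succ_pos _
    · have := (mem_innerDivisors.1 d.2).2.1
      exact Nat.totient_pos.2 (by omega)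
  rw [← card_filter_orderClass hn, Finset.card_pos] at hpos
  obtain ⟨x, hx⟩ := hpos
  exact ⟨x, by simpa using hx⟩

theorem coneGraph_adj_inl {n : ℕ} {u : Unit} {v : Unit ⊕ innerDivisors n} :
    (coneGraph n).Adj (Sum.inl u) v ↔ v ≠ Sum.inl u := by
  rcases v with w | d <;> simp [coneGraph, graphJoin]

theorem coneGraph_adj_inr {n : ℕ} {d e : innerDivisors n} :
    (coneGraph n).Adj (Sum.inr d) (Sum.inr e) ↔
      d ≠ e ∧ ((d : ℕ) ∣ e ∨ (e : ℕ) ∣ d) := by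
  simp [coneGraph, graphJoin, divisorGraph]

/-- The power graph is the blow-up of `H` in which each vertex becomes a clique. -/
theorem powerGraph_zmod_adj_iff {n : ℕ} [NeZero n] {x y : ZMod n} :
    (powerGraph (ZMod n)).Adj x y ↔
      x ≠ y ∧ (orderClass n x = orderClass n y ∨
        (coneGraph n).Adj (orderClass n x) (orderClass n y)) := by
  rw [powerGraph_adj_iff]
  refine and_congr_right fun hxy => ?_
  have apex : ∀ (z w : ZMod n) (u : Unit), orderClass n z = Sum.inl u →
      (addOrderOf w ∣ addOrderOf z ∨ addOrderOf z ∣ addOrderOf w) := by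
    intro z w u hz
    rcases orderClass_eq_inl.1 hz with h | h
    · exact Or.inr (h ▸ one_dvd _)
    · exact Or.inl ((addOrderOf_zmod_dvd w).trans h.symm.dvd)
  rcases hx : orderClass n x with u | d
  · simp only [apex x y u hx, true_iff, coneGraph_adj_inl]
    exact (em _).imp_right Ne.symm
  rcases hy : orderClass n y with u | e
  · simp only [(apex y x u hy).symm, true_iff]
    exact Or.inr (coneGraph_adj_inl.2 (by simp)).symm
  rw [orderClass_eq_inr.1 hx, orderClass_eq_inr.1 hy, coneGraph_adj_inr, Sum.inr.injEq]
  by_cases hde : d = e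
  · simp [hde]
  · simp [hde, or_comm]

theorem degree_powerGraph_zmod {n : ℕ} [NeZero n] (hn : 2 ≤ n) (x : ZMod n) :
    (powerGraph (ZMod n)).degree x + 1 =
      cliqueSize n (orderClass n x) + neighbourSum n (orderClass n x) := by
  have h1 : insert x ((powerGraph (ZMod n)).neighborFinset x) =
      (Finset.univ.filter fun y => orderClass n y = orderClass n x) ∪
        Finset.univ.filter fun y =>
          orderClass n y ∈ (coneGraph n).neighborFinset (orderClass n x) := by
    ext y
    simp only [Finset.mem_insert, SimpleGraph.mem_neighborFinset, powerGraph_zmod_adj_iff,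
      Finset.mem_union, Finset.mem_filter, Finset.mem_univ, true_and]
    by_cases hxy : y = x
    · simp [hxy]
    · simp [hxy, Ne.symm hxy, eq_comm]
  rw [← SimpleGraph.card_neighborFinset_eq_degree, ← Finset.card_insert_of_notMem
    (SimpleGraph.notMem_neighborFinset_self _ x), h1, Finset.card_union_of_disjoint,
    card_filter_orderClass hn, neighbourSum]
  · congr 1
    rw [Finset.card_eq_sum_card_fiberwise (f := orderClass n)
      (t := (coneGraph n).neighborFinset (orderClass n x)) (by intro y hy; simpa using hy)]
    refine Finset.sum_congr rfl fun w hw => ?_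
    rw [← card_filter_orderClass hn, Finset.filter_filter]
    congr 1
    ext y
    simp only [Finset.mem_filter, Finset.mem_univ, true_and, and_iff_right_iff_imp]
    rintro rfl
    exact hw
  · rw [Finset.disjoint_filter]
    intro y _ h h'
    rw [h] at h'
    simp at h'

/-- The apex of `H` is adjacent to all other vertices, and the cliques exhaust `ℤ/n`. -/
theorem cliqueSize_add_neighbourSum_inl {n : ℕ} [NeZero n] (hn : 2 ≤ n) (u : Unit) :
    cliqueSize n (Sum.inl u) + neighbourSum n (Sum.inl u) = n := by
  have h : (coneGraph n).neighborFinset (Sum.inl u) = Finset.univ.erase (Sum.inl u) := by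
    ext v
    simp [coneGraph_adj_inl]
  rw [neighbourSum, h, Finset.add_sum_erase _ _ (Finset.mem_univ _)]
  simp_rw [← card_filter_orderClass hn]
  rw [← Finset.card_eq_sum_card_fiberwise (by intro y _; simp)]
  simp [ZMod.card]

/-! ### The matrix `A_α` and its quotient -/

/-- The eigenvalue of `A_α` on the vectors that are supported on the clique of the vertex `v` of
`H` and have coordinate sum zero. At the apex it is
`α * n - 1`, by `cliqueSize_add_neighbourSum_inl`. -/
noncomputable def cliqueEigenvalue (n : ℕ) (α : ℝ) (v : Unit ⊕ innerDivisors n) : ℝ :=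
  α * ((cliqueSize n v : ℝ) + (neighbourSum n v : ℝ)) - 1

/-- The entries of `A_α` off the diagonal, as a function of the cliques of the two vertices. On the
diagonal it also has `1 - α`, the entry for two distinct vertices of the same clique; the value
`cliqueEigenvalue` corrects for this at the diagonal of `A_α`. -/
noncomputable def cliqueWeight (n : ℕ) (α : ℝ) :
    Matrix (Unit ⊕ innerDivisors n) (Unit ⊕ innerDivisors n) ℝ :=
  Matrix.of fun v w => if v = w ∨ (coneGraph n).Adj v w then 1 - α else 0

theorem aAlphaMatrix_powerGraph_zmod {n : ℕ} [NeZero n] (hn : 2 ≤ n) (α : ℝ) :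
    aAlphaMatrix (powerGraph (ZMod n)) α =
      Matrix.diagonal (fun x => cliqueEigenvalue n α (orderClass n x)) +
        (cliqueWeight n α).submatrix (orderClass n) (orderClass n) := by
  ext x y
  simp only [aAlphaMatrix, SimpleGraph.degMatrix, Matrix.add_apply, Matrix.smul_apply,
    SimpleGraph.adjMatrix_apply, Matrix.submatrix_apply, Matrix.diagonal_apply, smul_eq_mul,
    cliqueWeight, Matrix.of_apply, cliqueEigenvalue, powerGraph_zmod_adj_iff]
  by_cases hxy : x = y
  · subst hxy
    have h : ((powerGraph (ZMod n)).degree x : ℝ) + 1 =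
        cliqueSize n (orderClass n x) + neighbourSum n (orderClass n x) :=
      mod_cast degree_powerGraph_zmod hn x
    simp only [← h, if_true, ne_eq, not_true, false_and, if_false, true_or]
    ring
  · simp [hxy]

theorem quotientMatrix_eq {n : ℕ} [NeZero n] (hn : 2 ≤ n) (α : ℝ) :
    quotientMatrix n α = Matrix.diagonal (cliqueEigenvalue n α) +
      cliqueWeight n α * Matrix.diagonal fun v => (cliqueSize n v : ℝ) := by
  ext v w
  rw [Matrix.add_apply, Matrix.mul_diagonal]
  simp only [quotientMatrix, cliqueWeight, Matrix.of_apply, Matrix.diagonal_apply]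
  by_cases hvw : v = w
  · subst hvw
    simp only [if_true, true_or, cliqueEigenvalue]
    rcases v with u | d
    · have h : (cliqueSize n (Sum.inl u) : ℝ) + neighbourSum n (Sum.inl u) = n :=
        mod_cast cliqueSize_add_neighbourSum_inl hn u
      rw [h]
      simp only [quotientDiag, cliqueSize]
      push_cast
      ring
    · simp only [quotientDiag, cliqueSize]
      ring
  · simp [hvw]

theorem aAlphaMatrix_isHermitian {V : Type*} [Fintype V] [DecidableEq V] (G : SimpleGraph V)
    [DecidableRel G.Adj] (α : ℝ) : (aAlphaMatrix G α).IsHermitian := by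
  rw [Matrix.IsHermitian, Matrix.conjTranspose_eq_transpose_of_trivial]
  simp [aAlphaMatrix, SimpleGraph.degMatrix]

open Polynomial in
theorem charpoly_aAlphaMatrix_powerGraph_zmod {n : ℕ} [NeZero n] (hn : 2 ≤ n) (α : ℝ) :
    (aAlphaMatrix (powerGraph (ZMod n)) α).charpoly =
      (∏ v, (X - C (cliqueEigenvalue n α v)) ^ (cliqueSize n v - 1)) *
        (quotientMatrix n α).charpoly := by
  rw [aAlphaMatrix_powerGraph_zmod hn, quotientMatrix_eq hn,
    Matrix.charpoly_diagonal_add_submatrix _ (orderClass_surjective hn)]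
  simp only [card_filter_orderClass hn]

theorem mainTheorem7 (n : ℕ) [NeZero n] (hn : 2 ≤ n) (α : ℝ) (hα₀ : 0 ≤ α) (hα₁ : α ≤ 1) :
    realSpectrum (aAlphaMatrix (powerGraph (ZMod n)) α) =
      Multiset.replicate n.totient (α * (n : ℝ) - 1) +
      (∑ d : innerDivisors n,
        Multiset.replicate ((d : ℕ).totient - 1)
          (α * (((d : ℕ).totient : ℝ) + (neighbourSum n (Sum.inr d) : ℝ)) - 1)) +
      realSpectrum (quotientMatrix n α) ∧
    Multiset.card (realSpectrum (quotientMatrix n α)) = (innerDivisors n).card + 1 := by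
  have hchar := charpoly_aAlphaMatrix_powerGraph_zmod hn α
  have hne : (aAlphaMatrix (powerGraph (ZMod n)) α).charpoly ≠ 0 :=
    (Matrix.charpoly_monic _).ne_zero
  constructor
  · have hprod := left_ne_zero_of_mul (hchar ▸ hne)
    rw [realSpectrum, realSpectrum, hchar, Polynomial.roots_mul (hchar ▸ hne),
      Polynomial.roots_prod _ _ hprod]
    simp only [Polynomial.roots_pow, Polynomial.roots_X_sub_C, Multiset.nsmul_singleton]
    congr 1
    change ∑ v, Multiset.replicate (cliqueSize n v - 1) (cliqueEigenvalue n α v) = _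
    have h : (cliqueSize n (Sum.inl ()) : ℝ) + neighbourSum n (Sum.inl ()) = n :=
      mod_cast cliqueSize_add_neighbourSum_inl hn ()
    rw [Fintype.sum_sum_type, Fintype.sum_unique]
    congr 2
    exact congrArg (fun s => α * s - 1) h
  · -- The symmetric matrix has only real eigenvalues, hence so has the factor `M`.
    have hsplit : (quotientMatrix n α).charpoly.Splits :=
      (aAlphaMatrix_isHermitian _ α).splits_charpoly.of_dvd hne (Dvd.intro_left _ hchar.symm)
    rw [realSpectrum, ← hsplit.natDegree_eq_card_roots, Matrix.charpoly_natDegree_eq_dim]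
    simp [add_comm]
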